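/- Let $d\in\mathbb N$, let $\varphi\in H^1(\mathbb R^d)$ be complex-valued and let $\xi:\mathbb R^d\to\mathbb R$ be bounded and continuous. Assume that there are countably many pairwise disjoint open sets $\Omega_j\subseteq\mathbb R^d$ with Lipschitz boundary (near each of its boundary points, $\Omega_j$ is, after a rigid motion, the region on one side of the graph of a Lipschitz function) such that $$\mathbb R^d=\overline{\bigcup_{j}\Omega_j},$$ that the gradient $\nabla\xi=(\partial_1\xi,\dots,\partial_d\xi)$ exists at every point of $\mathbb R^d\setminus\bigcup_j\partial\Omega_j$, and that $\nabla\xi$ is bounded on this set. Then $\xi\varphi\in H^1(\mathbb R^d)$, $\xi^2\varphi\in H^1(\mathbb R^d)$, $|\nabla\xi|^2\varphi\in L^2(\mathbb R^d)$, and $$\mathrm{Re}\,\langle\nabla(\xi^2\varphi),\nabla\varphi\rangle=\langle\nabla(\xi\varphi),\nabla(\xi\varphi)\rangle-\langle\varphi,|\nabla\xi|^2\varphi\rangle,$$ where $\langle\cdot,\cdot\rangle$ is the inner product of $L^2(\mathbb R^d)$, respectively of $L^2(\mathbb R^d;\mathbb C^d)$, and the gradients of $\varphi$, $\xi\varphi$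 and $\xi^2\varphi$ are weak gradients. -/

import Mathlib

open MeasureTheory
open scoped ContDiff

noncomputable section

/-- The `i`-th unit coordinate vector of `ℝ^d`. -/
def unitVec {d : ℕ} (i : Fin d) : EuclideanSpace ℝ (Fin d) := EuclideanSpace.single i 1

/-- The classical `i`-th partial derivative `∂ᵢ f` at `x`. -/
def partialDeriv {d : ℕ} (i : Fin d) (f : EuclideanSpace ℝ (Fin d) → ℝ)
    (x : EuclideanSpace ℝ (Fin d)) : ℝ :=
  lineDeriv ℝ f x (unitVec i)

/-- The classical gradient of `f` exists at `x`: all partial derivatives exist there.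
(Total differentiability implies this.) -/
def GradExistsAt {d : ℕ} (f : EuclideanSpace ℝ (Fin d) → ℝ)
    (x : EuclideanSpace ℝ (Fin d)) : Prop :=
  ∀ i : Fin d, LineDifferentiableAt ℝ f x (unitVec i)

/-- The classical gradient `∇f = (∂₁ f, …, ∂_d f)` at `x`. -/
def classicalGrad {d : ℕ} (f : EuclideanSpace ℝ (Fin d) → ℝ)
    (x : EuclideanSpace ℝ (Fin d)) : EuclideanSpace ℝ (Fin d) :=
  WithLp.toLp 2 fun i => partialDeriv i f x

/-- `G = (G₁, …, G_d)` is the weak gradient of `f` on `ℝ^d`: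
`∫ (∂ᵢ h) f = - ∫ h Gᵢ` for all test functions `h ∈ C_c^∞(ℝ^d)` and all `i`. -/
structure HasWeakGradient {d : ℕ} (f : EuclideanSpace ℝ (Fin d) → ℂ)
    (G : EuclideanSpace ℝ (Fin d) → EuclideanSpace ℂ (Fin d)) : Prop where
  locallyIntegrable : LocallyIntegrable f volume
  locallyIntegrable_grad : LocallyIntegrable G volume
  integral_eq : ∀ h : EuclideanSpace ℝ (Fin d) → ℝ, ContDiff ℝ ∞ h → HasCompactSupport h →
    ∀ i : Fin d, ∫ x, (partialDeriv i h x : ℂ) * f x = - ∫ x, (h x : ℂ) * G x i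

/-- `f ∈ H¹(ℝ^d)`: `f` is square integrable and has a square integrable weak gradient. -/
def MemH1 {d : ℕ} (f : EuclideanSpace ℝ (Fin d) → ℂ) : Prop :=
  MemLp f 2 volume ∧
    ∃ G : EuclideanSpace ℝ (Fin d) → EuclideanSpace ℂ (Fin d),
      HasWeakGradient f G ∧ MemLp G 2 volume

/-- The `L²(ℝ^d)` inner product `⟨f, g⟩` of functions with values in a complex inner product
space `F` (here `F = ℂ` or `F = ℂ^d`). -/
def l2Inner {d : ℕ} {F : Type*} [NormedAddCommGroup F] [InnerProductSpace ℂ F]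
    (f g : EuclideanSpace ℝ (Fin d) → F) : ℂ :=
  ∫ x, inner ℂ (f x) (g x)

/-- `Ω` has Lipschitz boundary: near each boundary point `p` there are a unit vector `e` and a
Lipschitz function `g` of the component `y - ⟨e, y⟩ e` of `y` orthogonal to `e` such that `Ω`
coincides near `p` with the set `⟨e, y⟩ < g (y - ⟨e, y⟩ e)` on one side of the graph of `g`.
(Only the values of `g` on the hyperplane orthogonal to `e` are used; a Lipschitz function there,
or on a part of it, always extends to a Lipschitz function on the whole space.) -/
def HasLipschitzBoundary {d : ℕ} (Ω : Set (EuclideanSpace ℝ (Fin d))) : Prop :=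
  ∀ p ∈ frontier Ω, ∃ r > 0, ∃ e : EuclideanSpace ℝ (Fin d), ‖e‖ = 1 ∧
    ∃ (K : NNReal) (g : EuclideanSpace ℝ (Fin d) → ℝ), LipschitzWith K g ∧
      ∀ y ∈ Metric.ball p r, y ∈ Ω ↔ inner ℝ e y < g (y - (inner ℝ e y : ℝ) • e)

end

/-! The point is that `ξ` is globally Lipschitz; the rest is the product rule and pointwise algebra.

Almost every line in a coordinate direction meets all the boundaries in a countable set. Locally a
boundary lies in a Lipschitz graph, and the parameters at which a line meets that graph are read off
a fiber of a Lipschitz map `E → E`; by Rademacher and Sard almost every such fiber is discrete,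
hence countable (`LipschitzWith.ae_countable_preimage`). Countability matters: the Cantor function
shows that a null exceptional set would not suffice. On such a line the fundamental theorem of
calculus bounds the increments of `ξ`, and continuity extends the bound to every line
(`exists_lipschitzWith_of_classicalGrad_bounded`).

Mollification admits compactly supported Lipschitz test functions in the weak gradient identity.
Testing with `h * ξ` gives `∇(ξφ) = ξ∇φ + φ∇ξ` (`HasWeakGradient.mul_lipschitz`). Applying this
twice reduces the claim to `re_inner_localization`. -/

/-! ### Lines meeting Lipschitz graphs and boundaries -/

open Set Filter Topology NNReal in
/-- A Lipschitz map between spaces of the same dimension has countable fibers over almost every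
point. -/
theorem LipschitzWith.ae_countable_preimage {E : Type*} [NormedAddCommGroup E] [NormedSpace ℝ E]
    [FiniteDimensional ℝ E] [MeasurableSpace E] [BorelSpace E] (μ : Measure E)
    [μ.IsAddHaarMeasure] {K : ℝ≥0} {F : E → E} (hF : LipschitzWith K F) :
    ∀ᵐ y ∂μ, (F ⁻¹' {y}).Countable := by
  -- Top-dimensional Hausdorff measure dominates `μ`, and Lipschitz maps send its null sets to null
  -- sets.
  suffices h : ∀ᵐ y ∂(μH[Module.finrank ℝ E] : Measure E), (F ⁻¹' {y}).Countable from
    (Measure.absolutelyContinuous_isAddHaarMeasure μ _).ae_le h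
  set ν : Measure E := μH[Module.finrank ℝ E]
  have hnull : ν (F '' {x | ¬ DifferentiableAt ℝ F x}) = 0 := by
    have h0 : ν {x | ¬ DifferentiableAt ℝ F x} = 0 := hF.ae_differentiableAt (μ := ν)
    have h1 := hF.hausdorffMeasure_image_le (d := Module.finrank ℝ E) (by positivity)
      {x | ¬ DifferentiableAt ℝ F x}
    exact le_antisymm (h1.trans (by rw [show μH[_] _ = 0 from h0, mul_zero])) bot_le
  have hcrit : ν (F '' {x | DifferentiableAt ℝ F x ∧ (fderiv ℝ F x).det = 0}) = 0 :=
    MeasureTheory.addHaar_image_eq_zero_of_det_fderivWithin_eq_zero ν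
      (f' := fun x => fderiv ℝ F x)
      (fun x hx => hx.1.hasFDerivAt.hasFDerivWithinAt) (fun x hx => hx.2)
  filter_upwards [measure_eq_zero_iff_ae_notMem.1 hnull, measure_eq_zero_iff_ae_notMem.1 hcrit]
    with y hy1 hy2
  have hdisc : DiscreteTopology (F ⁻¹' {y}) := by
    rw [discreteTopology_subtype_iff]
    intro x hx
    have hd : DifferentiableAt ℝ F x := by
      by_contra h
      exact hy1 ⟨x, h, hx⟩
    have hdet : (fderiv ℝ F x).det ≠ 0 := fun h => hy2 ⟨x, ⟨hd, h⟩, hx⟩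
    -- An invertible derivative is bounded below, so `F ≠ y` on a punctured neighbourhood of `x`.
    have hanti : ∃ C, AntilipschitzWith C (fderiv ℝ F x) :=
      ⟨_, ((fderiv ℝ F x).toContinuousLinearEquivOfDetNeZero hdet).antilipschitz⟩
    have := hd.hasFDerivAt.eventually_ne (c := y) hanti
    rw [← disjoint_iff, disjoint_principal_right]
    filter_upwards [this] with z hz hzy using hz hzy
  exact (Set.countable_coe_iff).1 countable_of_Lindelof_of_discrete

open NNReal in
/-- Almost every line parallel to `v` meets the graph of a Lipschitz function in a countable set. -/
theorem LipschitzWith.ae_countable_line_inter_graph {E : Type*} [NormedAddCommGroup E]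
    [InnerProductSpace ℝ E] [FiniteDimensional ℝ E] [MeasurableSpace E] [BorelSpace E]
    (μ : Measure E) [μ.IsAddHaarMeasure] {K : ℝ≥0} {g : E → ℝ} (hg : LipschitzWith K g)
    {e : E} (he : ‖e‖ = 1) (v : E) :
    ∀ᵐ y ∂μ, {t : ℝ | inner ℝ e (y + t • v) =
      g ((y + t • v) - (inner ℝ e (y + t • v) : ℝ) • e)}.Countable := by
  set P : E →L[ℝ] E := ContinuousLinearMap.id ℝ E - (innerSL ℝ e).smulRight e with hP
  have hPz : ∀ z, P z = z - (inner ℝ e z : ℝ) • e := fun z => by simp [hP]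
  -- The graph point over `P z`, moved along `v` by the spare coordinate `⟨e, z⟩`. If `p = y + t •
  -- v` is on the graph, then `Φ (P p - t • e) = y`, so `t` is recovered from the fiber over `y` as
  -- `-⟨e, z⟩`.
  set Φ : E → E := fun z => P z + g (P z) • e + (inner ℝ e z : ℝ) • v with hΦ
  have hΦlip : ∃ C, LipschitzWith C Φ :=
    ⟨_, (P.lipschitz.add
      ((ContinuousLinearMap.toSpanSingleton ℝ e).lipschitz.comp (hg.comp P.lipschitz))).add
      ((innerSL ℝ e).smulRight v).lipschitz⟩
  obtain ⟨C, hC⟩ := hΦlip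
  filter_upwards [hC.ae_countable_preimage μ] with y hy
  refine (hy.image fun z => -(inner ℝ e z : ℝ)).mono ?_
  intro t ht
  have hee : (inner ℝ e e : ℝ) = 1 := by rw [real_inner_self_eq_norm_sq, he]; norm_num
  set p := y + t • v with hp
  have ht : inner ℝ e p = g (P p) := by rw [hPz]; exact ht
  have hPe : (inner ℝ e (P p) : ℝ) = 0 := by
    rw [hPz, inner_sub_right, inner_smul_right, hee]; ring
  have hin : (inner ℝ e (P p - t • e) : ℝ) = -t := by
    rw [inner_sub_right, hPe, inner_smul_right, hee]; ring
  have hPP : P (P p - t • e) = P p := by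
    rw [hPz (P p - t • e), hin]; simp
  refine ⟨P p - t • e, ?_, by simp only [hin, neg_neg]⟩
  show P (P p - t • e) + g (P (P p - t • e)) • e + (inner ℝ e (P p - t • e) : ℝ) • v = y
  rw [hPP, hin, ← ht, hPz, hp]
  simp

/-- Almost every line in a given direction meets the boundary of a set with Lipschitz boundary in
a countable set. -/
theorem HasLipschitzBoundary.ae_countable_line_inter_frontier {d : ℕ}
    {Ω : Set (EuclideanSpace ℝ (Fin d))} (hΩ : HasLipschitzBoundary Ω)
    (v : EuclideanSpace ℝ (Fin d)) :
    ∀ᵐ y, {t : ℝ | y + t • v ∈ frontier Ω}.Countable := by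
  choose! r hr e he K g hg hgraph using hΩ
  obtain ⟨s, hs, hsc, hcov⟩ := TopologicalSpace.countable_cover_nhdsWithin
    (f := fun p => Metric.ball p (r p)) (s := frontier Ω)
    (fun p hp => mem_nhdsWithin_of_mem_nhds (Metric.ball_mem_nhds p (hr p hp)))
  have key : ∀ p ∈ s, ∀ᵐ y, {t : ℝ | inner ℝ (e p) (y + t • v) =
      g p ((y + t • v) - (inner ℝ (e p) (y + t • v) : ℝ) • e p)}.Countable := fun p hp =>
    (hg p (hs hp)).ae_countable_line_inter_graph volume (he p (hs hp)) v
  filter_upwards [(ae_ball_iff hsc).2 key] with y hy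
  refine (hsc.biUnion hy).mono ?_
  intro t ht
  obtain ⟨p, hp, hpt⟩ := Set.mem_iUnion₂.1 (hcov ht)
  refine Set.mem_iUnion₂.2 ⟨p, hp, ?_⟩
  have hp' := hs hp
  set q := y + t • v with hq
  have hball : ∀ᶠ z in nhds q, z ∈ Metric.ball p (r p) := Metric.isOpen_ball.mem_nhds hpt
  have hgc := (hg p hp').continuous
  have hc1 : Continuous fun z : EuclideanSpace ℝ (Fin d) => (inner ℝ (e p) z : ℝ) := by fun_prop
  have hc2 : Continuous fun z : EuclideanSpace ℝ (Fin d) =>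
      g p (z - (inner ℝ (e p) z : ℝ) • e p) := by fun_prop
  -- Off the graph the strict inequality persists nearby, so `q` is interior to `Ω` or to its
  -- complement.
  rcases lt_trichotomy (inner ℝ (e p) q) (g p (q - (inner ℝ (e p) q : ℝ) • e p)) with h | h | h
  · have : ∀ᶠ z in nhds q, z ∈ Ω := by
      filter_upwards [hball, hc1.continuousAt.eventually_lt hc2.continuousAt h] with z hz1 hz2
        using (hgraph p hp' z hz1).2 hz2
    exact absurd (mem_interior_iff_mem_nhds.2 this) ht.2
  · exact h
  · have : Ωᶜ ∈ nhds q := by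
      filter_upwards [hball, hc2.continuousAt.eventually_lt hc1.continuousAt h] with z hz1 hz2
        using fun hz => (lt_asymm hz2 ((hgraph p hp' z hz1).1 hz))
    have h2 := mem_interior_iff_mem_nhds.2 this
    rw [interior_compl] at h2
    exact absurd ht.1 h2

/-! ### Global Lipschitz continuity from a bounded gradient -/

/-- A continuous function on `ℝ` whose derivative exists and is bounded by `M` off a countable set
is `M`-Lipschitz. -/
theorem abs_sub_le_of_abs_deriv_le_off_countable {f : ℝ → ℝ} (hf : Continuous f) {s : Set ℝ}
    (hs : s.Countable) {M : ℝ} (hd : ∀ t ∉ s, DifferentiableAt ℝ f t)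
    (hM : ∀ t ∉ s, |deriv f t| ≤ M) (a b : ℝ) : |f b - f a| ≤ M * |b - a| := by
  have hae : ∀ᵐ t, |deriv f t| ≤ M := by
    filter_upwards [measure_eq_zero_iff_ae_notMem.1 (hs.measure_zero volume)] with t ht using hM t ht
  have hint : IntervalIntegrable (deriv f) volume a b := by
    refine (intervalIntegrable_const (c := M)).mono_fun
      (measurable_deriv f).aestronglyMeasurable (ae_restrict_of_ae ?_)
    filter_upwards [hae] with t ht
    exact ht.trans (le_abs_self M)
  rw [← integral_eq_of_hasDerivAt_off_countable f (deriv f) hs hf.continuousOn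
    (fun t ht => (hd t ht.2).hasDerivAt) hint]
  rw [← Real.norm_eq_abs]
  exact intervalIntegral.norm_integral_le_of_norm_le_const_ae (hae.mono fun t ht _ => ht)

theorem LineDifferentiableAt.hasDerivAt_line {E : Type*} [NormedAddCommGroup E] [NormedSpace ℝ E]
    {f : E → ℝ} {y v : E} {t : ℝ} (h : LineDifferentiableAt ℝ f (y + t • v) v) :
    HasDerivAt (fun s : ℝ => f (y + s • v)) (lineDeriv ℝ f (y + t • v) v) t := by
  have h1 : HasDerivAt (fun s : ℝ => f ((y + t • v) + s • v)) (lineDeriv ℝ f (y + t • v) v)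
    (t - t) := by rw [sub_self]; exact h.hasLineDerivAt
  have h2 := h1.comp_sub_const t t
  refine h2.congr_of_eventuallyEq (Filter.Eventually.of_forall fun s => ?_)
  simp only [add_assoc, ← add_smul, add_sub_cancel]

theorem abs_partialDeriv_le_norm_classicalGrad {d : ℕ} (i : Fin d)
    (f : EuclideanSpace ℝ (Fin d) → ℝ) (x : EuclideanSpace ℝ (Fin d)) :
    |partialDeriv i f x| ≤ ‖classicalGrad f x‖ := by
  have := PiLp.norm_apply_le (classicalGrad f x) i
  simpa [classicalGrad] using this

/-- A continuous function with bounded increments along every coordinate line is Lipschitz. -/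
theorem lipschitzWith_of_coordinate_lipschitz {d : ℕ} {f : EuclideanSpace ℝ (Fin d) → ℝ} {M : ℝ}
    (hM : 0 ≤ M)
    (h : ∀ (i : Fin d) (y : EuclideanSpace ℝ (Fin d)) (t : ℝ),
      |f (y + t • unitVec i) - f y| ≤ M * |t|) :
    LipschitzWith (d * M).toNNReal f := by
  -- Coordinates are changed one at a time; `d` steps of length at most `dist x y` give the constant
  -- `d * M`.
  have hsum : ∀ (s : Finset (Fin d)) (c : Fin d → ℝ) (x : EuclideanSpace ℝ (Fin d)),
      |f (x + ∑ i ∈ s, c i • unitVec i) - f x| ≤ ∑ i ∈ s, M * |c i| := by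
    intro s c x
    induction s using Finset.induction_on with
    | empty => simp
    | insert a s ha ih =>
      rw [Finset.sum_insert ha, Finset.sum_insert ha, add_comm (c a • unitVec a), ← add_assoc]
      refine (abs_sub_le _ (f (x + ∑ i ∈ s, c i • unitVec i)) _).trans ?_
      exact add_le_add (h a _ _) ih
  refine LipschitzWith.of_dist_le_mul fun x y => ?_
  rw [Real.coe_toNNReal _ (by positivity), Real.dist_eq]
  have hxy : x = y + ∑ i, (x - y) i • unitVec i := by
    ext j
    simp [unitVec, Finset.sum_apply, Pi.single_apply]
  calc |f x - f y| ≤ ∑ i, M * |(x - y) i| := by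
        conv_lhs => rw [hxy]
        exact hsum _ _ _
    _ ≤ ∑ _i : Fin d, M * dist x y := by
        gcongr with i
        rw [dist_eq_norm]
        exact PiLp.norm_apply_le (x - y) i
    _ = d * M * dist x y := by simp [mul_assoc]

/-- A continuous function whose gradient exists and is bounded off countably many Lipschitz
boundaries is Lipschitz. -/
theorem exists_lipschitzWith_of_classicalGrad_bounded {d : ℕ} {ι : Type*} [Countable ι]
    {ξ : EuclideanSpace ℝ (Fin d) → ℝ} (hξ : Continuous ξ)
    {Ω : ι → Set (EuclideanSpace ℝ (Fin d))} (hΩ : ∀ j, HasLipschitzBoundary (Ω j))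
    (hgrad : ∀ x, x ∉ ⋃ j, frontier (Ω j) → GradExistsAt ξ x)
    (hbdd : ∃ M : ℝ, ∀ x, x ∉ ⋃ j, frontier (Ω j) → ‖classicalGrad ξ x‖ ≤ M) :
    ∃ K, LipschitzWith K ξ := by
  obtain ⟨M, hM⟩ := hbdd
  refine ⟨_, lipschitzWith_of_coordinate_lipschitz (M := max M 0) (le_max_right _ _) ?_⟩
  intro i y t
  have hae : ∀ᵐ y : EuclideanSpace ℝ (Fin d),
      |ξ (y + t • unitVec i) - ξ y| ≤ max M 0 * |t| := by
    filter_upwards [ae_all_iff.2 fun j =>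
      (hΩ j).ae_countable_line_inter_frontier (unitVec i)] with y hy
    have hline : ∀ t, t ∉ ⋃ j, {t : ℝ | y + t • unitVec i ∈ frontier (Ω j)} →
        y + t • unitVec i ∉ ⋃ j, frontier (Ω j) := by
      intro t ht
      simpa using ht
    have := abs_sub_le_of_abs_deriv_le_off_countable
      (f := fun s : ℝ => ξ (y + s • unitVec i)) (M := max M 0) (by fun_prop)
      (Set.countable_iUnion hy)
      (fun t ht => (LineDifferentiableAt.hasDerivAt_line (hgrad _ (hline t ht) i)).differentiableAt)
      (fun t ht => by
        rw [(LineDifferentiableAt.hasDerivAt_line (hgrad _ (hline t ht) i)).deriv]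
        exact ((abs_partialDeriv_le_norm_classicalGrad i ξ _).trans
          (hM _ (hline t ht))).trans (le_max_left _ _)) 0 t
    simpa using this
  -- For fixed `t` the bound is a closed condition on `y`, and a set of full measure is dense.
  have hclosed : IsClosed {y : EuclideanSpace ℝ (Fin d) |
      |ξ (y + t • unitVec i) - ξ y| ≤ max M 0 * |t|} :=
    isClosed_le (by fun_prop) continuous_const
  have := (Measure.dense_of_ae hae).closure_eq
  rw [hclosed.closure_eq] at this
  exact this.ge (Set.mem_univ y)

/-! ### Mollification of Lipschitz functions -/

theorem lineDeriv_eq_zero_of_notMem {E : Type*} [NormedAddCommGroup E] [NormedSpace ℝ E]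
    {f : E → ℝ} {S : Set E} (hS : IsClosed S) (hf : ∀ x ∉ S, f x = 0) {x : E} (hx : x ∉ S) (v : E) :
    lineDeriv ℝ f x v = 0 := by
  have h : f =ᶠ[nhds x] fun _ => 0 := by
    filter_upwards [hS.isOpen_compl.mem_nhds hx] with y hy using hf y hy
  rw [h.lineDeriv_eq]
  simp [lineDeriv]

-- The kernel is nonnegative with integral one, so the convolution is an average.
open scoped Convolution in
theorem ContDiffBump.abs_normed_convolution_le {E : Type*} [NormedAddCommGroup E]
    [NormedSpace ℝ E] [FiniteDimensional ℝ E] [MeasurableSpace E] [BorelSpace E] (μ : Measure E)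
    [μ.IsAddHaarMeasure] (η : ContDiffBump (0 : E)) {f : E → ℝ} {B : ℝ} (hf : ∀ x, |f x| ≤ B)
    (x : E) : |(η.normed μ ⋆[ContinuousLinearMap.lsmul ℝ ℝ, μ] f) x| ≤ B := by
  rw [MeasureTheory.convolution_def, ← Real.norm_eq_abs]
  refine (norm_integral_le_of_norm_le (η.integrable_normed.mul_const B)
    (Filter.Eventually.of_forall fun t => ?_)).trans_eq ?_
  · simp only [ContinuousLinearMap.lsmul_apply, smul_eq_mul, norm_mul, Real.norm_eq_abs,
      abs_of_nonneg (η.nonneg_normed t)]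
    exact mul_le_mul_of_nonneg_left (hf _) (η.nonneg_normed t)
  · rw [integral_mul_const, η.integral_normed, one_mul]

open scoped Convolution Topology in
/-- Mollification of a bounded Lipschitz function commutes with directional derivatives. -/
theorem LipschitzWith.lineDeriv_normed_convolution {E : Type*} [NormedAddCommGroup E]
    [NormedSpace ℝ E] [FiniteDimensional ℝ E] [MeasurableSpace E] [BorelSpace E] (μ : Measure E)
    [μ.IsAddHaarMeasure] (η : ContDiffBump (0 : E)) {f : E → ℝ} {K : NNReal}
    (hf : LipschitzWith K f) {B : ℝ} (hB : ∀ x, |f x| ≤ B) (x v : E) :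
    lineDeriv ℝ (η.normed μ ⋆[ContinuousLinearMap.lsmul ℝ ℝ, μ] f) x v =
      (η.normed μ ⋆[ContinuousLinearMap.lsmul ℝ ℝ, μ] fun y => lineDeriv ℝ f y v) x := by
  have hηc : Continuous (η.normed μ) := (η.contDiff_normed (n := 0)).continuous
  have hfc := hf.continuous
  have hmeas : Measurable fun y => lineDeriv ℝ f y v := measurable_lineDeriv hf.continuous
  have hdiff : ∀ᵐ t ∂μ, LineDifferentiableAt ℝ f (x - t) v :=
    (quasiMeasurePreserving_sub_left μ x).ae (hf.ae_lineDifferentiableAt v)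
  -- The increment is placed on `f`, whose difference quotients along `v` are at most `K * ‖v‖` and
  -- converge almost everywhere by Rademacher.
  have key := hasDerivAt_integral_of_dominated_loc_of_lip (μ := μ) (𝕜 := ℝ) (x₀ := (0 : ℝ))
    (s := Set.univ)
    (F := fun s t => η.normed μ t * f (x + s • v - t))
    (F' := fun t => η.normed μ t * lineDeriv ℝ f (x - t) v)
    (bound := fun t => η.normed μ t * (K * ‖v‖)) Filter.univ_mem
    (Filter.Eventually.of_forall fun s => by
      apply Continuous.aestronglyMeasurable
      fun_prop)
    (by
      refine η.integrable_normed.mul_bdd (c := B) ?_ ?_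
      · apply Continuous.aestronglyMeasurable
        fun_prop
      · exact Filter.Eventually.of_forall fun t => hB _)
    (hηc.measurable.mul (hmeas.comp (measurable_const.sub measurable_id))).aestronglyMeasurable
    (Filter.Eventually.of_forall fun t => by
      refine LipschitzOnWith.of_dist_le_mul fun a _ b _ => ?_
      have h1 : 0 ≤ η.normed μ t := η.nonneg_normed t
      have h2 : 0 ≤ η.normed μ t * (K * ‖v‖) := by positivity
      have h3 := hf.dist_le_mul (x + a • v - t) (x + b • v - t)
      rw [dist_sub_right, dist_add_left, dist_eq_norm (a • v), ← sub_smul, norm_smul,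
        ← dist_eq_norm a b] at h3
      rw [Real.coe_nnabs, abs_of_nonneg h2, Real.dist_eq, ← mul_sub, abs_mul, abs_of_nonneg h1,
        ← Real.dist_eq]
      calc η.normed μ t * dist (f (x + a • v - t)) (f (x + b • v - t))
          ≤ η.normed μ t * (K * (dist a b * ‖v‖)) := by gcongr
        _ = _ := by ring)
    (η.integrable_normed.mul_const _)
    (by
      filter_upwards [hdiff] with t ht
      have := (ht.hasLineDerivAt.const_mul (η.normed μ t) :)
      refine HasDerivAt.congr_of_eventuallyEq this (Filter.Eventually.of_forall fun s => ?_)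
      simp only [add_sub_right_comm])
  exact key.2.deriv

open scoped Convolution Topology Pointwise in
/-- A compactly supported Lipschitz function is the limit of test functions with uniform bounds
and a common compact support, whose directional derivatives converge almost everywhere. -/
theorem LipschitzWith.exists_contDiff_approx {E : Type*} [NormedAddCommGroup E]
    [NormedSpace ℝ E] [FiniteDimensional ℝ E] [MeasurableSpace E] [BorelSpace E] (μ : Measure E)
    [μ.IsAddHaarMeasure] {k : E → ℝ} {K : NNReal} (hk : LipschitzWith K k)
    (hkc : HasCompactSupport k) (v : E) :
    ∃ (S : Set E) (B : ℝ) (u : ℕ → E → ℝ), IsCompact S ∧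
      (∀ n, ContDiff ℝ ∞ (u n)) ∧ (∀ n, HasCompactSupport (u n)) ∧
      (∀ n, ∀ x ∉ S, u n x = 0) ∧ (∀ n, ∀ x ∉ S, lineDeriv ℝ (u n) x v = 0) ∧
      (∀ n x, |u n x| ≤ B) ∧ (∀ n x, |lineDeriv ℝ (u n) x v| ≤ B) ∧
      (∀ x, Filter.Tendsto (fun n => u n x) Filter.atTop (𝓝 (k x))) ∧
      ∀ᵐ x ∂μ, Filter.Tendsto (fun n => lineDeriv ℝ (u n) x v) Filter.atTop
        (𝓝 (lineDeriv ℝ k x v)) := by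
  obtain ⟨B, hB⟩ := hk.continuous.bounded_above_of_compact_support hkc
  simp only [Real.norm_eq_abs] at hB
  have hpos : ∀ n : ℕ, (0 : ℝ) < 1 / (n + 1) := fun n => by positivity
  -- Outer radii at most 1 keep all supports in one compact set; the bounded ratio of outer to inner
  -- radius is what almost everywhere convergence of the derivatives needs.
  let η : ℕ → ContDiffBump (0 : E) := fun n =>
    ⟨1 / (n + 1) / 2, 1 / (n + 1), half_pos (hpos n), half_lt_self (hpos n)⟩
  have hη0 : Filter.Tendsto (fun n => (η n).rOut) Filter.atTop (𝓝 0) :=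
    tendsto_one_div_add_atTop_nhds_zero_nat
  have hη2 : ∀ n, (η n).rOut ≤ 2 * (η n).rIn := fun n => by
    show (1 : ℝ) / (n + 1) ≤ 2 * (1 / (n + 1) / 2)
    linarith
  have hη1 : ∀ n, (η n).rOut ≤ 1 := fun n => by
    show (1 : ℝ) / (n + 1) ≤ 1
    rw [div_le_one (by positivity)]
    linarith [(Nat.cast_nonneg n : (0 : ℝ) ≤ n)]
  let u : ℕ → E → ℝ := fun n => (η n).normed μ ⋆[ContinuousLinearMap.lsmul ℝ ℝ, μ] k
  have hS : IsCompact (Metric.closedBall (0 : E) 1 + tsupport k) :=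
    (isCompact_closedBall 0 1).add hkc
  have hu0 : ∀ n, ∀ x ∉ Metric.closedBall (0 : E) 1 + tsupport k, u n x = 0 := by
    intro n x hx
    by_contra h
    refine hx (Set.add_subset_add ?_ (subset_tsupport k)
      (support_convolution_subset (ContinuousLinearMap.lsmul ℝ ℝ) h))
    rw [(η n).support_normed_eq]
    exact (Metric.ball_subset_ball (hη1 n)).trans Metric.ball_subset_closedBall
  have hld : ∀ n x, lineDeriv ℝ (u n) x v = ((η n).normed μ
      ⋆[ContinuousLinearMap.lsmul ℝ ℝ, μ] fun y => lineDeriv ℝ k y v) x :=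
    fun n x => hk.lineDeriv_normed_convolution μ (η n) hB x v
  refine ⟨Metric.closedBall (0 : E) 1 + tsupport k, max B (K * ‖v‖), u, hS, ?_, ?_, hu0, ?_, ?_,
    ?_, ?_, ?_⟩
  · exact fun n => (η n).hasCompactSupport_normed.contDiff_convolution_left _
      (η n).contDiff_normed hk.continuous.locallyIntegrable
  · exact fun n => (η n).hasCompactSupport_normed.convolution _ hkc
  · exact fun n x hx => lineDeriv_eq_zero_of_notMem hS.isClosed (hu0 n) hx v
  · exact fun n x => ((η n).abs_normed_convolution_le μ hB x).trans (le_max_left _ _)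
  · intro n x
    rw [hld]
    exact ((η n).abs_normed_convolution_le μ
      (fun y => norm_lineDeriv_le_of_lipschitz ℝ hk) x).trans (le_max_right _ _)
  · exact fun x => ContDiffBump.convolution_tendsto_right_of_continuous hη0 hk.continuous x
  · simp only [hld]
    exact ContDiffBump.ae_convolution_tendsto_right_of_locallyIntegrable hη0
      (Filter.Eventually.of_forall hη2) (hk.locallyIntegrable_lineDeriv v)

/-! ### Lipschitz test functions for weak gradients -/

-- Dominated by `B * ‖f‖` on `S`: the common compact support makes local integrability enough. It
-- serves both sides of the weak gradient identity.
open scoped Topology in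
theorem MeasureTheory.LocallyIntegrable.tendsto_integral_mul {E : Type*} [NormedAddCommGroup E]
    [NormedSpace ℝ E] [MeasurableSpace E] [BorelSpace E] {μ : Measure E} {f : E → ℂ}
    (hf : LocallyIntegrable f μ) {S : Set E} (hS : IsCompact S) {B : ℝ} {u : ℕ → E → ℝ} {w : E → ℝ}
    (hm : ∀ n, Measurable (u n)) (h0 : ∀ n, ∀ x ∉ S, u n x = 0) (hB : ∀ n x, |u n x| ≤ B)
    (hlim : ∀ᵐ x ∂μ, Filter.Tendsto (fun n => u n x) Filter.atTop (𝓝 (w x))) :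
    Filter.Tendsto (fun n => ∫ x, (u n x : ℂ) * f x ∂μ) Filter.atTop
      (𝓝 (∫ x, (w x : ℂ) * f x ∂μ)) := by
  refine tendsto_integral_of_dominated_convergence (S.indicator fun x => B * ‖f x‖) (fun n => ?_)
    ?_ (fun n => Filter.Eventually.of_forall fun x => ?_) ?_
  · have hcl : (fun x => (u n x : ℂ) * f x) = S.indicator fun x => (u n x : ℂ) * f x := by
      ext x
      by_cases hx : x ∈ S
      · simp [hx]
      · simp [hx, h0 n x hx]
    rw [hcl, aestronglyMeasurable_indicator_iff hS.measurableSet]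
    exact (Complex.measurable_ofReal.comp (hm n)).aestronglyMeasurable.mul
      (hf.integrableOn_isCompact hS).aestronglyMeasurable
  · rw [integrable_indicator_iff hS.measurableSet]
    exact (hf.integrableOn_isCompact hS).norm.const_mul B
  · by_cases hx : x ∈ S
    · simp only [hx, Set.indicator_of_mem, norm_mul, Complex.norm_real, Real.norm_eq_abs]
      exact mul_le_mul_of_nonneg_right (hB n x) (norm_nonneg _)
    · simp [hx, h0 n x hx]
  · filter_upwards [hlim] with x hx
    exact ((Complex.continuous_ofReal.tendsto _).comp hx).mul_const _

theorem MeasureTheory.LocallyIntegrable.euclidean_apply {E : Type*} [NormedAddCommGroup E]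
    [MeasurableSpace E] {μ : Measure E} {d : ℕ} {G : E → EuclideanSpace ℂ (Fin d)}
    (hG : LocallyIntegrable G μ) (i : Fin d) : LocallyIntegrable (fun x => G x i) μ := by
  intro x
  obtain ⟨s, hs, hGs⟩ := hG x
  exact ⟨s, hs, (EuclideanSpace.proj (𝕜 := ℂ) i).integrable_comp hGs⟩

/-- The defining identity of the weak gradient extends to compactly supported Lipschitz test
functions. -/
theorem HasWeakGradient.integral_eq_of_lipschitz {d : ℕ} {f : EuclideanSpace ℝ (Fin d) → ℂ}
    {G : EuclideanSpace ℝ (Fin d) → EuclideanSpace ℂ (Fin d)} (hf : HasWeakGradient f G)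
    {k : EuclideanSpace ℝ (Fin d) → ℝ} {K : NNReal} (hk : LipschitzWith K k)
    (hkc : HasCompactSupport k) (i : Fin d) :
    ∫ x, (partialDeriv i k x : ℂ) * f x = - ∫ x, (k x : ℂ) * G x i := by
  obtain ⟨S, B, u, hS, hu, huc, hu0, hdu0, huB, hduB, hlim, hdlim⟩ :=
    hk.exists_contDiff_approx volume hkc (unitVec i)
  have h1 := hf.locallyIntegrable.tendsto_integral_mul hS
    (fun n => measurable_lineDeriv (hu n).continuous) hdu0 hduB hdlim
  have h2 := (hf.locallyIntegrable_grad.euclidean_apply i).tendsto_integral_mul hS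
    (fun n => (hu n).continuous.measurable) hu0 huB (Filter.Eventually.of_forall hlim)
  refine tendsto_nhds_unique h1 (h2.neg.congr fun n => ?_)
  exact (hf.integral_eq (u n) (hu n) (huc n) i).symm

/-! ### Product rule and uniqueness of weak gradients -/

/-- The classical gradient of a real function as a vector in `ℂ^d`. -/
noncomputable def complexGrad {d : ℕ} (f : EuclideanSpace ℝ (Fin d) → ℝ)
    (x : EuclideanSpace ℝ (Fin d)) : EuclideanSpace ℂ (Fin d) :=
  WithLp.toLp 2 fun i => (partialDeriv i f x : ℂ)

theorem complexGrad_apply {d : ℕ} (f : EuclideanSpace ℝ (Fin d) → ℝ)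
    (x : EuclideanSpace ℝ (Fin d)) (i : Fin d) : complexGrad f x i = (partialDeriv i f x : ℂ) := rfl

theorem norm_complexGrad {d : ℕ} (f : EuclideanSpace ℝ (Fin d) → ℝ)
    (x : EuclideanSpace ℝ (Fin d)) : ‖complexGrad f x‖ = ‖classicalGrad f x‖ := by
  simp [EuclideanSpace.norm_eq, complexGrad, classicalGrad]

theorem measurable_complexGrad {d : ℕ} {f : EuclideanSpace ℝ (Fin d) → ℝ} (hf : Continuous f) :
    Measurable (complexGrad f) :=
  (WithLp.measurable_toLp 2 _).comp
    (measurable_pi_lambda _ fun _ => Complex.measurable_ofReal.comp (measurable_lineDeriv hf))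

/-- The bound holds at every point, boundaries included, because `lineDeriv` is 0 where the
derivative fails to exist. -/
theorem LipschitzWith.exists_norm_complexGrad_le {d : ℕ} {f : EuclideanSpace ℝ (Fin d) → ℝ}
    {K : NNReal} (hf : LipschitzWith K f) : ∃ M : ℝ, ∀ x, ‖complexGrad f x‖ ≤ M := by
  refine ⟨√(∑ _i : Fin d, (K : ℝ) ^ 2), fun x => ?_⟩
  rw [EuclideanSpace.norm_eq]
  gcongr with i
  rw [complexGrad_apply, Complex.norm_real]
  refine (norm_lineDeriv_le_of_lipschitz ℝ hf).trans_eq ?_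
  simp [unitVec]

theorem LipschitzWith.mul_of_bounded {E : Type*} [PseudoMetricSpace E] {f g : E → ℝ}
    {K L A B : NNReal} (hf : LipschitzWith K f) (hg : LipschitzWith L g) (hA : ∀ x, |f x| ≤ A)
    (hB : ∀ x, |g x| ≤ B) : LipschitzWith (A * L + B * K) fun x => f x * g x := by
  refine LipschitzWith.of_dist_le_mul fun x y => ?_
  have h1 := hf.dist_le_mul x y
  have h2 := hg.dist_le_mul x y
  rw [Real.dist_eq] at h1 h2 ⊢
  push_cast
  calc |f x * g x - f y * g y| = |f x * (g x - g y) + g y * (f x - f y)| := by ring_nf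
    _ ≤ |f x| * |g x - g y| + |g y| * |f x - f y| := by
        rw [← abs_mul, ← abs_mul]; exact abs_add_le _ _
    _ ≤ A * (L * dist x y) + B * (K * dist x y) := by
        gcongr
        · exact hA x
        · exact hB y
    _ = _ := by ring

/-- Weak product rule with a bounded Lipschitz factor. -/
theorem HasWeakGradient.mul_lipschitz {d : ℕ} {f : EuclideanSpace ℝ (Fin d) → ℂ}
    {G : EuclideanSpace ℝ (Fin d) → EuclideanSpace ℂ (Fin d)} (hf : HasWeakGradient f G)
    {ξ : EuclideanSpace ℝ (Fin d) → ℝ} {K : NNReal} (hξ : LipschitzWith K ξ)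
    {B : NNReal} (hB : ∀ x, |ξ x| ≤ B)
    (h1 : LocallyIntegrable (fun x => (ξ x : ℂ) * f x) volume)
    (h2 : LocallyIntegrable (fun x => (ξ x : ℂ) • G x) volume)
    (h3 : LocallyIntegrable (fun x => f x • complexGrad ξ x) volume) :
    HasWeakGradient (fun x => (ξ x : ℂ) * f x)
      (fun x => (ξ x : ℂ) • G x + f x • complexGrad ξ x) := by
  refine ⟨h1, h2.add h3, fun h hh hc i => ?_⟩
  obtain ⟨L, hL⟩ := hh.lipschitzWith_of_hasCompactSupport hc (by simp)
  obtain ⟨A, hA⟩ := hh.continuous.bounded_above_of_compact_support hc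
  have hA' : ∀ x, |h x| ≤ A.toNNReal := fun x => (hA x).trans (Real.le_coe_toNNReal A)
  -- The test function `h * ξ` is Lipschitz with compact support; Leibniz holds for it almost
  -- everywhere, and the term with `∂ᵢ ξ` becomes part of the new gradient.
  have key := hf.integral_eq_of_lipschitz (hL.mul_of_bounded hξ hA' hB) hc.mul_right i
  have hcont : Continuous fun x => partialDeriv i h x := by
    have : (fun x => partialDeriv i h x) = fun x => fderiv ℝ h x (unitVec i) := by
      ext x
      exact (hh.differentiable (by simp) x).lineDeriv_eq_fderiv
    rw [this]
    exact (hh.continuous_fderiv (by simp)).clm_apply continuous_const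
  have hcs : HasCompactSupport fun x => partialDeriv i h x := by
    refine HasCompactSupport.of_support_subset_isCompact hc fun x hx => ?_
    by_contra hx'
    exact hx (lineDeriv_eq_zero_of_notMem (isClosed_tsupport h)
      (fun y hy => image_eq_zero_of_notMem_tsupport hy) hx' _)
  have hprod : ∀ᵐ x, partialDeriv i (fun x => h x * ξ x) x =
      partialDeriv i h x * ξ x + h x * partialDeriv i ξ x := by
    filter_upwards [hξ.ae_lineDifferentiableAt (unitVec i)] with x hx
    have h1 := ((hh.differentiable (by simp) x).lineDifferentiableAt
      (v := unitVec i)).hasLineDerivAt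
    have h2 := HasDerivAt.mul h1 hx.hasLineDerivAt
    have h3 : partialDeriv i (fun x => h x * ξ x) x = _ := h2.deriv
    simpa [partialDeriv] using h3
  have i1 : Integrable fun x => (partialDeriv i h x : ℂ) * ((ξ x : ℂ) * f x) := by
    simpa only [Complex.real_smul] using
      h1.integrable_smul_left_of_hasCompactSupport hcont hcs
  have i2 : Integrable fun x => (h x : ℂ) * (f x * (partialDeriv i ξ x : ℂ)) := by
    simpa only [Complex.real_smul, PiLp.smul_apply, complexGrad_apply, smul_eq_mul] using
      (h3.euclidean_apply i).integrable_smul_left_of_hasCompactSupport hh.continuous hc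
  have i3 : Integrable fun x => (h x : ℂ) * ((ξ x : ℂ) * G x i) := by
    simpa only [Complex.real_smul, PiLp.smul_apply, smul_eq_mul] using
      (h2.euclidean_apply i).integrable_smul_left_of_hasCompactSupport hh.continuous hc
  have hl : ∫ x, (partialDeriv i (fun x => h x * ξ x) x : ℂ) * f x =
      (∫ x, (partialDeriv i h x : ℂ) * ((ξ x : ℂ) * f x)) +
        ∫ x, (h x : ℂ) * (f x * (partialDeriv i ξ x : ℂ)) := by
    rw [← integral_add i1 i2]
    refine integral_congr_ae ?_
    filter_upwards [hprod] with x hx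
    rw [hx]
    push_cast
    ring
  have hr : ∫ x, ((h x * ξ x : ℝ) : ℂ) * G x i = ∫ x, (h x : ℂ) * ((ξ x : ℂ) * G x i) := by
    congr 1
    ext x
    push_cast
    ring
  rw [hl, hr] at key
  rw [eq_sub_of_add_eq key, ← neg_add', ← integral_add i3 i2]
  congr 2
  ext x
  simp only [PiLp.add_apply, PiLp.smul_apply, smul_eq_mul, complexGrad_apply]
  ring

/-- Weak gradients are unique almost everywhere. -/
theorem HasWeakGradient.ae_eq {d : ℕ} {f : EuclideanSpace ℝ (Fin d) → ℂ}
    {G G' : EuclideanSpace ℝ (Fin d) → EuclideanSpace ℂ (Fin d)} (hG : HasWeakGradient f G)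
    (hG' : HasWeakGradient f G') : G =ᵐ[volume] G' := by
  have hi : ∀ i : Fin d, ∀ᵐ x, G x i = G' x i := by
    intro i
    refine ae_eq_of_integral_contDiff_smul_eq (hG.locallyIntegrable_grad.euclidean_apply i)
      (hG'.locallyIntegrable_grad.euclidean_apply i) fun h hh hc => ?_
    simp only [Complex.real_smul]
    exact neg_injective ((hG.integral_eq h hh hc i).symm.trans (hG'.integral_eq h hh hc i))
  filter_upwards [ae_all_iff.2 hi] with x hx
  ext i
  exact hx i

theorem MeasureTheory.MemLp.mul_bounded_continuous {d : ℕ} {F : Type*} [NormedAddCommGroup F]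
    [NormedSpace ℂ F] {f : EuclideanSpace ℝ (Fin d) → F} (hf : MemLp f 2 volume)
    {ξ : EuclideanSpace ℝ (Fin d) → ℝ} (hξ : Continuous ξ) {B : ℝ} (hB : ∀ x, |ξ x| ≤ B) :
    MemLp (fun x => (ξ x : ℂ) • f x) 2 volume := by
  refine hf.of_le_mul (c := B) ?_ (Filter.Eventually.of_forall fun x => ?_)
  · exact (Complex.continuous_ofReal.comp hξ).aestronglyMeasurable.smul hf.aestronglyMeasurable
  · rw [norm_smul, Complex.norm_real]
    exact mul_le_mul_of_nonneg_right (hB x) (norm_nonneg _)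

theorem LipschitzWith.memLp_smul_complexGrad {d : ℕ} {f : EuclideanSpace ℝ (Fin d) → ℂ}
    (hf : MemLp f 2 volume) {ξ : EuclideanSpace ℝ (Fin d) → ℝ} {K : NNReal}
    (hξ : LipschitzWith K ξ) : MemLp (fun x => f x • complexGrad ξ x) 2 volume := by
  obtain ⟨M, hM⟩ := hξ.exists_norm_complexGrad_le
  refine hf.of_le_mul (c := M) ?_ (Filter.Eventually.of_forall fun x => ?_)
  · exact hf.aestronglyMeasurable.smul (measurable_complexGrad hξ.continuous).aestronglyMeasurable
  · rw [norm_smul, mul_comm]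
    exact mul_le_mul_of_nonneg_right (hM x) (norm_nonneg _)

/-- Multiplication by a bounded Lipschitz function preserves `H¹`, with the product rule. -/
theorem HasWeakGradient.mul_lipschitz_of_memLp {d : ℕ} {f : EuclideanSpace ℝ (Fin d) → ℂ}
    {G : EuclideanSpace ℝ (Fin d) → EuclideanSpace ℂ (Fin d)} (hf : HasWeakGradient f G)
    (hf2 : MemLp f 2 volume) (hG2 : MemLp G 2 volume)
    {ξ : EuclideanSpace ℝ (Fin d) → ℝ} {K : NNReal} (hξ : LipschitzWith K ξ)
    {B : NNReal} (hB : ∀ x, |ξ x| ≤ B) :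
    MemLp (fun x => (ξ x : ℂ) * f x) 2 volume ∧
    MemLp (fun x => (ξ x : ℂ) • G x + f x • complexGrad ξ x) 2 volume ∧
    HasWeakGradient (fun x => (ξ x : ℂ) * f x)
      (fun x => (ξ x : ℂ) • G x + f x • complexGrad ξ x) := by
  have m1 : MemLp (fun x => (ξ x : ℂ) * f x) 2 volume := hf2.mul_bounded_continuous hξ.continuous hB
  have m2 := hG2.mul_bounded_continuous hξ.continuous hB
  have m3 := hξ.memLp_smul_complexGrad hf2
  exact ⟨m1, m2.add m3, hf.mul_lipschitz hξ hB (m1.locallyIntegrable one_le_two)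
    (m2.locallyIntegrable one_le_two) (m3.locallyIntegrable one_le_two)⟩

/-! ### The localization identity -/

/-- The pointwise form of the localization identity. -/
theorem re_inner_localization {n : ℕ} (a : ℝ) (z : ℂ) (G : EuclideanSpace ℂ (Fin n))
    (w : EuclideanSpace ℂ (Fin n)) :
    ((inner ℂ ((a : ℂ) • ((a : ℂ) • G + z • w) + ((a : ℂ) * z) • w) G : ℂ).re : ℂ) =
      inner ℂ ((a : ℂ) • G + z • w) ((a : ℂ) • G + z • w) -
        inner ℂ z (((‖w‖ ^ 2 : ℝ) : ℂ) * z) := by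
  have hself : ∀ u : EuclideanSpace ℂ (Fin n), (inner ℂ u u : ℂ) = ((‖u‖ ^ 2 : ℝ) : ℂ) := fun u => by
    rw [inner_self_eq_norm_sq_to_K]
    push_cast
    rfl
  have hz : inner ℂ z (((‖w‖ ^ 2 : ℝ) : ℂ) * z) = (inner ℂ (z • w) (z • w) : ℂ) := by
    rw [inner_smul_left, inner_smul_right, hself, RCLike.inner_apply]
    ring
  have hGw : (inner ℂ G (z • w) : ℂ) = (starRingEnd ℂ) (inner ℂ (z • w) G) :=
    (inner_conj_symm _ _).symm
  -- With `c = ⟨z • w, G⟩`, the cross terms are `2 * a * c` here and `a * (c + conj c)` in `e2`: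
  -- equal real parts, so only `‖z • w‖ ^ 2` remains.
  have e1 : (inner ℂ ((a : ℂ) • ((a : ℂ) • G + z • w) + ((a : ℂ) * z) • w) G : ℂ) =
      (a : ℂ) ^ 2 * inner ℂ G G + 2 * a * inner ℂ (z • w) G := by
    rw [mul_smul]
    simp only [inner_add_left, inner_smul_left (𝕜 := ℂ) _ _ (a : ℂ), Complex.conj_ofReal]
    ring
  have e2 : (inner ℂ ((a : ℂ) • G + z • w) ((a : ℂ) • G + z • w) : ℂ) =
      (a : ℂ) ^ 2 * inner ℂ G G + a * (inner ℂ (z • w) G + inner ℂ G (z • w))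
        + inner ℂ (z • w) (z • w) := by
    simp only [inner_add_left, inner_add_right, inner_smul_left (𝕜 := ℂ) _ _ (a : ℂ),
      inner_smul_right (𝕜 := ℂ) _ _ (a : ℂ), Complex.conj_ofReal]
    ring
  rw [hz, e1, e2, hGw, Complex.add_conj, hself G]
  have : ((a : ℂ) ^ 2 * ((‖G‖ ^ 2 : ℝ) : ℂ) + 2 * a * inner ℂ (z • w) G : ℂ).re =
      a ^ 2 * ‖G‖ ^ 2 + 2 * a * (inner ℂ (z • w) G : ℂ).re := by
    rw [Complex.add_re, ← Complex.ofReal_pow, ← Complex.ofReal_mul, Complex.ofReal_re,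
      show (2 * a : ℂ) = ((2 * a : ℝ) : ℂ) by push_cast; rfl, Complex.re_ofReal_mul]
  rw [this]
  push_cast
  ring

theorem MeasureTheory.MemLp.integrable_inner_complex {α E : Type*} [MeasurableSpace α]
    {μ : Measure α} [NormedAddCommGroup E] [InnerProductSpace ℂ E] {f g : α → E}
    (hf : MemLp f 2 μ) (hg : MemLp g 2 μ) : Integrable (fun x => (inner ℂ (f x) (g x) : ℂ)) μ := by
  refine (hf.norm.integrable_mul hg.norm).mono'
    (hf.aestronglyMeasurable.inner hg.aestronglyMeasurable) (Filter.Eventually.of_forall fun x => ?_)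
  exact norm_inner_le_norm _ _

theorem theorem3 {d : ℕ} {ι : Type*} [Countable ι]
    (φ : EuclideanSpace ℝ (Fin d) → ℂ) (hφ : MemH1 φ)
    (ξ : EuclideanSpace ℝ (Fin d) → ℝ) (hξ_cont : Continuous ξ)
    (hξ_bdd : ∃ C : ℝ, ∀ x, |ξ x| ≤ C)
    (Ω : ι → Set (EuclideanSpace ℝ (Fin d)))
    (hΩ_open : ∀ j, IsOpen (Ω j))
    (hΩ_lip : ∀ j, HasLipschitzBoundary (Ω j))
    (hΩ_disj : Pairwise fun i j => Disjoint (Ω i) (Ω j))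
    (hΩ_cover : closure (⋃ j, Ω j) = Set.univ)
    (hξ_grad : ∀ x, x ∉ ⋃ j, frontier (Ω j) → GradExistsAt ξ x)
    (hξ_grad_bdd : ∃ M : ℝ, ∀ x, x ∉ ⋃ j, frontier (Ω j) → ‖classicalGrad ξ x‖ ≤ M) :
    MemH1 (fun x => (ξ x : ℂ) * φ x) ∧
    MemH1 (fun x => (ξ x : ℂ) ^ 2 * φ x) ∧
    MemLp (fun x => ((‖classicalGrad ξ x‖ ^ 2 : ℝ) : ℂ) * φ x) 2 volume ∧
    ∀ Gφ Gξφ Gξξφ : EuclideanSpace ℝ (Fin d) → EuclideanSpace ℂ (Fin d),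
      HasWeakGradient φ Gφ →
      HasWeakGradient (fun x => (ξ x : ℂ) * φ x) Gξφ →
      HasWeakGradient (fun x => (ξ x : ℂ) ^ 2 * φ x) Gξξφ →
      ((l2Inner Gξξφ Gφ).re : ℂ) =
        l2Inner Gξφ Gξφ
          - l2Inner φ (fun x => ((‖classicalGrad ξ x‖ ^ 2 : ℝ) : ℂ) * φ x) := by
  obtain ⟨K, hK⟩ := exists_lipschitzWith_of_classicalGrad_bounded hξ_cont hΩ_lip hξ_grad
    hξ_grad_bdd
  obtain ⟨C, hC⟩ := hξ_bdd
  have hB : ∀ x, |ξ x| ≤ C.toNNReal := fun x => (hC x).trans (Real.le_coe_toNNReal C)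
  obtain ⟨hφ2, G, hG, hG2⟩ := hφ
  obtain ⟨m1, n1, w1⟩ := hG.mul_lipschitz_of_memLp hφ2 hG2 hK hB
  -- The product rule applied to `ξφ` yields `ξ(ξ∇φ + φ∇ξ) + ξφ∇ξ`, the form expected by
  -- `re_inner_localization`.
  obtain ⟨m2, n2, w2⟩ := w1.mul_lipschitz_of_memLp m1 n1 hK hB
  have hsq : (fun x => (ξ x : ℂ) * ((ξ x : ℂ) * φ x)) = fun x => (ξ x : ℂ) ^ 2 * φ x := by
    ext x
    ring
  rw [hsq] at m2 w2
  have m3 : MemLp (fun x => ((‖classicalGrad ξ x‖ ^ 2 : ℝ) : ℂ) * φ x) 2 volume := by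
    obtain ⟨M, hM⟩ := hK.exists_norm_complexGrad_le
    simp only [← norm_complexGrad]
    refine hφ2.of_le_mul (c := M ^ 2) ?_ (Filter.Eventually.of_forall fun x => ?_)
    · exact (Complex.measurable_ofReal.comp
        ((measurable_complexGrad hξ_cont).norm.pow_const 2)).aestronglyMeasurable.mul
        hφ2.aestronglyMeasurable
    · rw [norm_mul, Complex.norm_real, norm_pow, norm_norm]
      gcongr
      exact hM x
  refine ⟨⟨m1, _, w1, n1⟩, ⟨m2, _, w2, n2⟩, m3, fun Gφ Gξφ Gξξφ h0 h1 h2 => ?_⟩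
  -- The given weak gradients are not assumed square integrable; uniqueness transfers this from the
  -- constructed ones.
  have a0 := h0.ae_eq hG
  have a1 := h1.ae_eq w1
  have a2 := h2.ae_eq w2
  have i1 : Integrable fun x => (inner ℂ (Gξξφ x) (Gφ x) : ℂ) :=
    (n2.ae_eq a2.symm).integrable_inner_complex (hG2.ae_eq a0.symm)
  have i2 : Integrable fun x => (inner ℂ (Gξφ x) (Gξφ x) : ℂ) :=
    (n1.ae_eq a1.symm).integrable_inner_complex (n1.ae_eq a1.symm)
  have i3 : Integrable fun x =>
      (inner ℂ (φ x) (((‖classicalGrad ξ x‖ ^ 2 : ℝ) : ℂ) * φ x) : ℂ) :=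
    hφ2.integrable_inner_complex m3
  unfold l2Inner
  rw [← integral_sub i2 i3]
  have hre : (∫ x, (inner ℂ (Gξξφ x) (Gφ x) : ℂ)).re = ∫ x, (inner ℂ (Gξξφ x) (Gφ x) : ℂ).re :=
    (integral_re i1).symm
  rw [hre, ← integral_complex_ofReal]
  refine integral_congr_ae ?_
  filter_upwards [a0, a1, a2] with x e0 e1 e2
  rw [e0, e1, e2, ← norm_complexGrad]
  exact re_inner_localization (ξ x) (φ x) (G x) (complexGrad ξ x)
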